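/- Let $s\in(0,1)$ and let $n\ge 1$ be an integer with $n>4s$. Write $\langle y\rangle=(1+|y|^2)^{1/2}$ for $y\in\mathbb R^n$, and let $$(-\Delta)^s u(x)=C_{n,s}\,\mathrm{P.V.}\!\int_{\mathbb R^n}\frac{u(x)-u(y)}{|x-y|^{n+2s}}\,dy,\qquad C_{n,s}=\frac{s\,4^s\,\Gamma(\frac n2+s)}{\pi^{n/2}\,\Gamma(1-s)} .$$ For $\mu\in(0,\tfrac12)$ and $a,b>0$ let $$F(a,b)=\frac{a+b}{2}-\sqrt{\Big(\frac{a-b}{2}\Big)^2+\mu ab}.$$ For a finite family of bubble parameters $\lambda_j>0$, $z_j\in\mathbb R^n$ $(1\le j\le \nu)$ put $y_j=\lambda_j(x-z_j)$. For $R>0$ and an index set $J\subset\{1,\dots,\nu\}$ define $$\tilde W_J(x)=\sum_{j\in J}\lambda_j^{\frac{n-2s}{2}}F\Big(\frac{R^{2s-n}}{\langle y_j\rangle^{2s}},\frac{R^{-4s}}{\langle y_j\rangle^{n-4s}}\Big),\qquad \tilde V_J(x)=\sum_{j\in J}\lambda_j^{\frac{n+2s}{2}}F\Big(\frac{R^{2s-n}}{\langle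 y_j\rangle^{4s}},\frac{R^{-4s}}{\langle y_j\rangle^{n-2s}}\Big),$$ and, for an index $i\in\{1,\dots,\nu\}$, $$\tilde W=\tilde W_J+\frac{\lambda_i^{\frac{n-2s}{2}}R^{2s-n}}{\langle y_i\rangle^{2s}}\chi_{\{|y_i|\le R\}},\qquad \tilde V=\tilde V_J+\frac{\lambda_i^{\frac{n+2s}{2}}R^{2s-n}}{\langle y_i\rangle^{4s}}\chi_{\{|y_i|\le R\}}.$$ (This includes the case $R=\frac12\min_{k\ne l}\max\big(\sqrt{\lambda_k/\lambda_l},\sqrt{\lambda_l/\lambda_k},\sqrt{\lambda_k\lambda_l}\,|z_k-z_l|\big)$ for $\nu\ge2$, with $J$ the set of indices of the bubbles that are more concentrated than the $i$-th one and form a tower or a cluster with it.) Then there is a constant $\alpha_{n,s}>0$ depending only on $n$ and $s$ (in particular not on $\nu,\lambda_j,z_j,\mu,R,i,J$) such that all the principal values below exist and 1. $(-\Delta)^s\big[(1+|x|^2)^{-s}\big]\ge\alpha_{n,s}\,(1+|x|^2)^{-2s}$ for all $x\in\mathbb R^n$; 2. $(-\Delta)^s\tilde W_J(x)\ge\alpha_{n,s}\,\tilde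 V_J(x)$ for all $x\in\mathbb R^n$; 3. $(-\Delta)^s\tilde W(x)\ge\alpha_{n,s}\,\tilde V(x)$ for all $x\in\mathbb R^n$ with $|y_i|<R$. -/

import Mathlib

open Set Filter Topology MeasureTheory

noncomputable section

/-- The normalizing constant
`C_{n,s} = s 4^s Γ(n/2 + s) / (π^{n/2} Γ(1 - s))` of the singular integral representation of the
fractional Laplacian (the one for which `(-Δ)^s` has Fourier symbol `|ξ|^{2s}`). -/
def fracLapConst (n : ℕ) (s : ℝ) : ℝ :=
  s * (4 : ℝ) ^ s * Real.Gamma ((n : ℝ) / 2 + s)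
    / (Real.pi ^ ((n : ℝ) / 2) * Real.Gamma (1 - s))

/-- `HasFracLaplacianAt s u x L` : the principal value integral
`C_{n,s} P.V. ∫ (u x - u y) / |x - y|^{n+2s} dy` defining `(-Δ)^s u (x)` exists and equals `L`,
i.e. the integrand is integrable off every ball around `x`, and the integrals over the complements
of the balls `B(x, ε)` converge as `ε → 0+`. -/
def HasFracLaplacianAt {n : ℕ} (s : ℝ) (u : EuclideanSpace ℝ (Fin n) → ℝ)
    (x : EuclideanSpace ℝ (Fin n)) (L : ℝ) : Prop :=
  (∀ ε : ℝ, 0 < ε →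
    IntegrableOn (fun y => (u x - u y) / ‖x - y‖ ^ ((n : ℝ) + 2 * s)) (Metric.ball x ε)ᶜ) ∧
  Tendsto
    (fun ε : ℝ => fracLapConst n s *
      ∫ y in (Metric.ball x ε)ᶜ, (u x - u y) / ‖x - y‖ ^ ((n : ℝ) + 2 * s))
    (𝓝[>] 0) (𝓝 L)

/-- The bracket `⟨y⟩ = (1 + |y|²)^{1/2}`. -/
def jbracket {n : ℕ} (y : EuclideanSpace ℝ (Fin n)) : ℝ := Real.sqrt (1 + ‖y‖ ^ 2)

/-- The smooth approximation of `min a b` with parameter `μ`. -/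
def smoothMin (μ a b : ℝ) : ℝ :=
  (a + b) / 2 - Real.sqrt (((a - b) / 2) ^ 2 + μ * a * b)

/-- The rescaled coordinate `y = l (x - c)` of the bubble with concentration `l` and centre `c`. -/
def bubbleCoord {n : ℕ} (l : ℝ) (c x : EuclideanSpace ℝ (Fin n)) : EuclideanSpace ℝ (Fin n) :=
  l • (x - c)

/-- The inner weight
`w_{i,1}(x) = l^{(n-2s)/2} R^{2s-n} ⟨y⟩^{-2s} χ_{|y| ≤ R}`, `y = l (x - c)`. -/
def weightWInner {n : ℕ} (s R l : ℝ) (c x : EuclideanSpace ℝ (Fin n)) : ℝ :=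
  Set.indicator {x : EuclideanSpace ℝ (Fin n) | ‖bubbleCoord l c x‖ ≤ R}
    (fun x => l ^ (((n : ℝ) - 2 * s) / 2) * R ^ (2 * s - (n : ℝ))
      / jbracket (bubbleCoord l c x) ^ (2 * s)) x

/-- The inner weight
`v_{i,1}(x) = l^{(n+2s)/2} R^{2s-n} ⟨y⟩^{-4s} χ_{|y| ≤ R}`, `y = l (x - c)`. -/
def weightVInner {n : ℕ} (s R l : ℝ) (c x : EuclideanSpace ℝ (Fin n)) : ℝ :=
  Set.indicator {x : EuclideanSpace ℝ (Fin n) | ‖bubbleCoord l c x‖ ≤ R}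
    (fun x => l ^ (((n : ℝ) + 2 * s) / 2) * R ^ (2 * s - (n : ℝ))
      / jbracket (bubbleCoord l c x) ^ (4 * s)) x

/-- The smoothed part of the weight `W̃`:
`∑_{j ∈ J} λ_j^{(n-2s)/2} F(R^{2s-n} / ⟨y_j⟩^{2s}, R^{-4s} / ⟨y_j⟩^{n-4s})`. -/
def smoothSumW {n ν : ℕ} (s μ R : ℝ) (lam : Fin ν → ℝ) (z : Fin ν → EuclideanSpace ℝ (Fin n))
    (J : Finset (Fin ν)) (x : EuclideanSpace ℝ (Fin n)) : ℝ :=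
  ∑ j ∈ J, lam j ^ (((n : ℝ) - 2 * s) / 2) *
    smoothMin μ
      (R ^ (2 * s - (n : ℝ)) / jbracket (bubbleCoord (lam j) (z j) x) ^ (2 * s))
      (R ^ (-(4 * s)) / jbracket (bubbleCoord (lam j) (z j) x) ^ ((n : ℝ) - 4 * s))

/-- The smoothed part of the weight `Ṽ`:
`∑_{j ∈ J} λ_j^{(n+2s)/2} F(R^{2s-n} / ⟨y_j⟩^{4s}, R^{-4s} / ⟨y_j⟩^{n-2s})`. -/
def smoothSumV {n ν : ℕ} (s μ R : ℝ) (lam : Fin ν → ℝ) (z : Fin ν → EuclideanSpace ℝ (Fin n))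
    (J : Finset (Fin ν)) (x : EuclideanSpace ℝ (Fin n)) : ℝ :=
  ∑ j ∈ J, lam j ^ (((n : ℝ) + 2 * s) / 2) *
    smoothMin μ
      (R ^ (2 * s - (n : ℝ)) / jbracket (bubbleCoord (lam j) (z j) x) ^ (4 * s))
      (R ^ (-(4 * s)) / jbracket (bubbleCoord (lam j) (z j) x) ^ ((n : ℝ) - 2 * s))

/-- The weight `W̃` attached to the bubble `i` and the set of bubbles `J`. -/
def tildeW {n ν : ℕ} (s μ R : ℝ) (lam : Fin ν → ℝ) (z : Fin ν → EuclideanSpace ℝ (Fin n))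
    (i : Fin ν) (J : Finset (Fin ν)) (x : EuclideanSpace ℝ (Fin n)) : ℝ :=
  smoothSumW s μ R lam z J x + weightWInner s R (lam i) (z i) x

/-- The weight `Ṽ` attached to the bubble `i` and the set of bubbles `J`. -/
def tildeV {n ν : ℕ} (s μ R : ℝ) (lam : Fin ν → ℝ) (z : Fin ν → EuclideanSpace ℝ (Fin n))
    (i : Fin ν) (J : Finset (Fin ν)) (x : EuclideanSpace ℝ (Fin n)) : ℝ :=
  smoothSumV s μ R lam z J x + weightVInner s R (lam i) (z i) x

end

/-! Everything is compared with the bubble `U = ⟨y⟩^{-N}`, `N = n - 2s`. The Kelvin transform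
centred at `x` with radius `⟨x⟩` leaves `U` invariant. It turns the integral of `(U(x) - U(y))/|x -
y|^{n+2s}` over `|x - y| ≥ ε` into a positive multiple of the integral of `|y - x|^{-N} - U(y)` over
a ball about `x`. This is nonnegative by a rearrangement argument (`truncFracLap_bubble_nonneg`).

For `0 < p < N` the profile `⟨y⟩^{-p}` is the concave power `U^{p/N}`, so it lies below a multiple
of `U`, up to a constant, touching it at `x`. For `|y| ≥ K⟨x⟩` a gap of size `c ⟨x⟩^{-p}` remains
(`isBubbleConcaveAt_inv_jbracket_rpow`). Integrated against the kernel, the bubble part is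
nonnegative and the gap yields at least a constant times `⟨x⟩^{-2s}` times the profile at `x`
(`IsBubbleConcaveAt.le_truncFracLap`). The condition `n > 4s` puts both exponents `2s` and `n - 4s`
in `(0, N)`.

This touching property survives positive multiples, the smooth minimum (concave, nondecreasing and
1-homogeneous where its arguments are positive), and a cut-off whose set contains `x`. As `F` is
1-homogeneous, multiplying a `W`-summand by `λ^{2s}⟨y⟩^{-2s}` gives exactly the matching
`V`-summand. Sums follow by linearity of the truncated integrals, and the limit `ε → 0` exists
because the weights are bounded, measurable and `C²` near the point. -/

/-! ### Existence of the principal value -/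

section Existence

variable {n : ℕ} {s : ℝ} {u : EuclideanSpace ℝ (Fin n) → ℝ} {x : EuclideanSpace ℝ (Fin n)}

/-- The truncated singular integral `∫_{|x - y| ≥ ε} (u x - u y) / |x - y|^{n+2s} dy`. -/
noncomputable def truncFracLap (s : ℝ) (u : EuclideanSpace ℝ (Fin n) → ℝ)
    (x : EuclideanSpace ℝ (Fin n)) (ε : ℝ) : ℝ :=
  ∫ y in (Metric.ball x ε)ᶜ, (u x - u y) / ‖x - y‖ ^ ((n : ℝ) + 2 * s)

theorem integrableOn_compl_ball_norm_sub_rpow_inv (hs : 0 < s)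
    (x : EuclideanSpace ℝ (Fin n)) {ε : ℝ} (hε : 0 < ε) :
    IntegrableOn (fun y => (‖x - y‖ ^ ((n : ℝ) + 2 * s))⁻¹) (Metric.ball x ε)ᶜ := by
  have h1 : Integrable (fun y : EuclideanSpace ℝ (Fin n) => (1 + ‖y‖) ^ (-((n : ℝ) + 2 * s))) :=
    integrable_one_add_norm (by simp; positivity)
  have h2 := ((h1.comp_sub_left x).const_mul ((1 + ε⁻¹) ^ ((n : ℝ) + 2 * s))).integrableOn
    (s := (Metric.ball x ε)ᶜ)
  refine Integrable.mono' h2 (Measurable.aestronglyMeasurable (by fun_prop)) ?_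
  refine (ae_restrict_iff' Metric.isOpen_ball.measurableSet.compl).2 (Eventually.of_forall ?_)
  intro y hy
  have hy' : ε ≤ ‖x - y‖ := by
    simpa [dist_eq_norm, norm_sub_rev] using hy
  have hr : 0 < ‖x - y‖ := hε.trans_le hy'
  have h3 : 1 + ‖x - y‖ ≤ (1 + ε⁻¹) * ‖x - y‖ := by
    have : 1 ≤ ε⁻¹ * ‖x - y‖ := by rw [inv_mul_eq_div, one_le_div hε]; exact hy'
    linarith
  rw [Real.norm_of_nonneg (by positivity), Real.rpow_neg (by positivity), ← div_eq_mul_inv,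
    le_div_iff₀ (by positivity), inv_mul_le_iff₀ (by positivity), mul_comm (_ ^ _),
    ← Real.mul_rpow (by positivity) (by positivity)]
  exact Real.rpow_le_rpow (by positivity) h3 (by positivity)

theorem integrableOn_truncFracLap (hs : 0 < s) (hu : Measurable u) {C : ℝ}
    (hC : ∀ y, |u y| ≤ C) (x : EuclideanSpace ℝ (Fin n)) {ε : ℝ} (hε : 0 < ε) :
    IntegrableOn (fun y => (u x - u y) / ‖x - y‖ ^ ((n : ℝ) + 2 * s)) (Metric.ball x ε)ᶜ := by
  simp_rw [div_eq_mul_inv]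
  refine Integrable.bdd_mul (c := C + C) (integrableOn_compl_ball_norm_sub_rpow_inv hs x hε)
    (Measurable.aestronglyMeasurable (by fun_prop)) (Eventually.of_forall fun y => ?_)
  exact (norm_sub_le _ _).trans (add_le_add (hC x) (hC y))

/-- The reflection `y ↦ 2x - y` preserves the annulus and changes the sign of the integrand. -/
theorem integral_inter_compl_ball_linear_eq_zero (φ : EuclideanSpace ℝ (Fin n) →L[ℝ] ℝ)
    (x : EuclideanSpace ℝ (Fin n)) (p δ ε : ℝ) :
    ∫ y in Metric.ball x δ ∩ (Metric.ball x ε)ᶜ, φ (y - x) / ‖x - y‖ ^ p = 0 := by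
  have hm : MeasurableSet (Metric.ball x δ ∩ (Metric.ball x ε)ᶜ) :=
    measurableSet_ball.inter measurableSet_ball.compl
  rw [← integral_indicator hm]
  set G := (Metric.ball x δ ∩ (Metric.ball x ε)ᶜ).indicator
    (fun y => φ (y - x) / ‖x - y‖ ^ p) with hG
  have h1 : ∫ y, G y = ∫ y, G ((x + x) - y) := (integral_sub_left_eq_self G volume (x + x)).symm
  have h2 : ∀ y, G ((x + x) - y) = - G y := by
    intro y
    have hmem : ((x + x) - y ∈ Metric.ball x δ ∩ (Metric.ball x ε)ᶜ) ↔
        (y ∈ Metric.ball x δ ∩ (Metric.ball x ε)ᶜ) := by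
      have : dist ((x + x) - y) x = dist y x := by
        rw [dist_eq_norm, dist_eq_norm, ← norm_neg]; congr 1; abel
      simp only [mem_inter_iff, mem_compl_iff, Metric.mem_ball, this]
    by_cases hy : y ∈ Metric.ball x δ ∩ (Metric.ball x ε)ᶜ
    · rw [hG, indicator_of_mem (hmem.2 hy), indicator_of_mem hy]
      have e1 : (x + x) - y - x = -(y - x) := by abel
      have e2 : x - ((x + x) - y) = -(x - y) := by abel
      rw [e1, e2, norm_neg, map_neg, neg_div]
    · rw [hG, indicator_of_notMem (mt hmem.1 hy), indicator_of_notMem hy, neg_zero]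
  simp_rw [h2, integral_neg] at h1
  linarith

theorem ContDiffAt.exists_norm_sub_sub_fderiv_le (hu : ContDiffAt ℝ 2 u x) :
    ∃ K δ : ℝ, 0 ≤ K ∧ 0 < δ ∧ ∀ y ∈ Metric.ball x δ,
      |u x - u y + fderiv ℝ u x (y - x)| ≤ K * ‖x - y‖ ^ 2 := by
  obtain ⟨K, t, ht, hK⟩ :=
    (hu.fderiv_right (m := 1) (by norm_num)).exists_lipschitzOnWith
  have hd : ∀ᶠ y in 𝓝 x, DifferentiableAt ℝ u y :=
    (hu.eventually (by simp)).mono fun y hy => hy.differentiableAt (by simp)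
  obtain ⟨δ, hδ, hδt⟩ := Metric.mem_nhds_iff.1 (inter_mem ht hd)
  refine ⟨K, δ, K.2, hδ, fun y hy => ?_⟩
  have hsub : Metric.closedBall x ‖x - y‖ ⊆ Metric.ball x δ := by
    apply Metric.closedBall_subset_ball
    rwa [Metric.mem_ball, dist_comm, dist_eq_norm] at hy
  have hb : ∀ z ∈ Metric.closedBall x ‖x - y‖, ‖fderiv ℝ u z - fderiv ℝ u x‖ ≤ K * ‖x - y‖ := by
    intro z hz
    refine (hK.norm_sub_le (hδt (hsub hz)).1 (hδt (Metric.mem_ball_self hδ)).1).trans ?_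
    rw [Metric.mem_closedBall, dist_eq_norm] at hz
    gcongr
  have := (convex_closedBall x ‖x - y‖).norm_image_sub_le_of_norm_fderiv_le'
    (φ := fderiv ℝ u x) (f := u)
    (fun z hz => (hδt (hsub hz)).2) hb (Metric.mem_closedBall_self (norm_nonneg _))
    (show y ∈ Metric.closedBall x ‖x - y‖ by
      rw [Metric.mem_closedBall, dist_comm, dist_eq_norm])
  rw [Real.norm_eq_abs, ← abs_neg, norm_sub_rev y x, mul_assoc, ← sq] at this
  convert this using 2
  ring

/-- Near `x` the first-order Taylor term is added to the numerator. It integrates to zero on annuli,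
so the truncated integrals are unchanged, while the corrected integrand is `O(|x - y|^{2-n-2s})`,
hence integrable as `s < 1`. Dominated convergence then gives the limit. -/
theorem exists_hasFracLaplacianAt (hn : 1 ≤ n) (hs0 : 0 < s) (hs1 : s < 1) (hu : Measurable u)
    {C : ℝ} (hC : ∀ y, |u y| ≤ C) (hx : ContDiffAt ℝ 2 u x) :
    ∃ L, HasFracLaplacianAt s u x L := by
  obtain ⟨K, δ, hK0, hδ, hK⟩ := hx.exists_norm_sub_sub_fderiv_le
  set φ := fderiv ℝ u x
  set f := fun y => (u x - u y) / ‖x - y‖ ^ ((n : ℝ) + 2 * s) with hf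
  set g := (Metric.ball x δ).indicator (fun y => φ (y - x) / ‖x - y‖ ^ ((n : ℝ) + 2 * s)) with hg
  have hgm : Measurable g :=
    Measurable.indicator (by fun_prop) measurableSet_ball
  have hint : ∀ ε, 0 < ε → IntegrableOn f (Metric.ball x ε)ᶜ := fun ε hε =>
    integrableOn_truncFracLap hs0 hu hC x hε
  have hfg : Integrable (fun y => f y + g y) := by
    rw [← integrableOn_univ, ← union_compl_self (Metric.ball x δ)]
    refine IntegrableOn.union ?_ ?_
    · have h0 := integrableOn_ball_of_norm_le_rpow (μ := volume) (E := EuclideanSpace ℝ (Fin n))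
        (f := fun y => f (x - y) + g (x - y)) (C := K) (α := n + 2 * s - 2) (r := δ)
        (by simpa using hn) (by simp; linarith)
        ((ae_restrict_iff' measurableSet_ball).2 (Eventually.of_forall fun y hy => ?_))
        (Measurable.aestronglyMeasurable (by fun_prop))
      · rw [← integrable_indicator_iff measurableSet_ball] at h0 ⊢
        have := h0.comp_sub_left x
        refine this.congr (Eventually.of_forall fun y => ?_)
        have hmem : x - y ∈ Metric.ball (0 : EuclideanSpace ℝ (Fin n)) δ ↔ y ∈ Metric.ball x δ := by
          simp [dist_eq_norm, norm_sub_rev]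
        by_cases hy : y ∈ Metric.ball x δ
        · simp only [indicator_of_mem hy, indicator_of_mem (hmem.2 hy), sub_sub_cancel]
        · simp only [indicator_of_notMem hy, indicator_of_notMem (mt hmem.1 hy)]
      · have hmem : x - y ∈ Metric.ball x δ := by simpa [dist_eq_norm] using hy
        have := hK _ hmem
        simp only [hf, hg, indicator_of_mem hmem, ← add_div, sub_sub_cancel] at this ⊢
        rcases eq_or_ne y 0 with rfl | hy0
        · rw [norm_zero, Real.zero_rpow (by positivity)]
          simp only [div_zero, norm_zero]
          positivity
        · have hy1 : 0 < ‖y‖ := norm_pos_iff.2 hy0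
          rw [norm_div, Real.norm_of_nonneg (by positivity : 0 ≤ ‖y‖ ^ ((n : ℝ) + 2 * s)),
            div_le_iff₀ (by positivity), mul_assoc, ← Real.rpow_add hy1]
          have e : -((n : ℝ) + 2 * s - 2) + (n + 2 * s) = (2 : ℕ) := by push_cast; ring
          rwa [e, Real.rpow_natCast]
    · refine (hint δ hδ).congr_fun (fun y hy => ?_) measurableSet_ball.compl
      simp [hg, indicator_of_notMem hy]
  refine ⟨fracLapConst n s * ∫ y, (f y + g y), hint, Tendsto.const_mul _ ?_⟩
  have hlim : Tendsto (fun ε : ℝ => ∫ y in (Metric.ball x ε)ᶜ, (f y + g y)) (𝓝[>] 0)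
      (𝓝 (∫ y, (f y + g y))) := by
    simp_rw [← integral_indicator measurableSet_ball.compl]
    refine tendsto_integral_filter_of_dominated_convergence (fun y => ‖f y + g y‖)
      (Eventually.of_forall fun ε => ?_) (Eventually.of_forall fun ε => ?_) hfg.norm
      (Eventually.of_forall fun y => ?_)
    · exact hfg.1.indicator measurableSet_ball.compl
    · exact Eventually.of_forall fun y => norm_indicator_le_norm_self _ _
    · rcases eq_or_ne y x with rfl | hy
      · have : f y + g y = 0 := by simp [hf, hg, indicator]
        refine tendsto_const_nhds.congr fun ε => ?_
        simp only [indicator, this, ite_self]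
      · have : ∀ᶠ ε : ℝ in 𝓝[>] 0, ε < dist y x :=
          eventually_nhdsWithin_of_eventually_nhds (eventually_lt_nhds (dist_pos.2 hy))
        refine tendsto_const_nhds.congr' ?_
        filter_upwards [this] with ε hε
        rw [indicator_of_mem (by simpa using hε.le)]
  refine hlim.congr' ?_
  filter_upwards [self_mem_nhdsWithin] with ε hε
  have hgε : IntegrableOn g (Metric.ball x ε)ᶜ := by
    refine (hfg.integrableOn.sub (hint ε hε)).congr (Eventually.of_forall fun y => ?_)
    simp
  rw [integral_add (hint ε hε) hgε, hg, setIntegral_indicator measurableSet_ball, inter_comm,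
    integral_inter_compl_ball_linear_eq_zero, add_zero]

end Existence

/-! ### Kelvin transform and positivity for the bubble -/

section Positivity

variable {n : ℕ} {s : ℝ}

theorem jbracket_pos (y : EuclideanSpace ℝ (Fin n)) : 0 < jbracket y :=
  Real.sqrt_pos.2 (by positivity)

theorem jbracket_sq (y : EuclideanSpace ℝ (Fin n)) : jbracket y ^ 2 = 1 + ‖y‖ ^ 2 :=
  Real.sq_sqrt (by positivity)

theorem one_le_jbracket (y : EuclideanSpace ℝ (Fin n)) : 1 ≤ jbracket y :=
  Real.one_le_sqrt.2 (by nlinarith [sq_nonneg ‖y‖])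

theorem norm_le_jbracket (y : EuclideanSpace ℝ (Fin n)) : ‖y‖ ≤ jbracket y :=
  Real.le_sqrt_of_sq_le (by linarith)

theorem contDiff_jbracket {m : WithTop ℕ∞} :
    ContDiff ℝ m (jbracket : EuclideanSpace ℝ (Fin n) → ℝ) :=
  (contDiff_const.add (contDiff_norm_sq ℝ)).sqrt fun y => by positivity

theorem continuous_jbracket : Continuous (jbracket : EuclideanSpace ℝ (Fin n) → ℝ) :=
  (contDiff_jbracket (m := 0)).continuous

/-- In one more dimension, `⟨y⟩` is the distance from `(y, 0)` to the pole `(0, 1)`. The sphere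
about `(x, 0)` of radius `⟨x⟩` passes through the pole, so inversion fixes it, and the formula is
the usual distortion of distances. The computation below is the direct expansion. -/
theorem jbracket_inversion {x y : EuclideanSpace ℝ (Fin n)} (hy : y ≠ x) :
    jbracket (EuclideanGeometry.inversion x (jbracket x) y)
      = jbracket x * jbracket y / dist y x := by
  have hd : 0 < dist y x := dist_pos.2 hy
  have key : 1 + ‖EuclideanGeometry.inversion x (jbracket x) y‖ ^ 2
      = (jbracket x * jbracket y / dist y x) ^ 2 := by
    rw [EuclideanGeometry.inversion, vsub_eq_sub, vadd_eq_add, div_pow, div_pow, mul_pow,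
      jbracket_sq, jbracket_sq]
    obtain ⟨v, rfl⟩ : ∃ v, y = v + x := ⟨y - x, by abel⟩
    rw [dist_eq_norm, add_sub_cancel_right] at hd ⊢
    rw [norm_add_sq_real v x, norm_add_sq_real (_ • v) x, norm_smul,
      inner_smul_left, Real.norm_of_nonneg (by positivity)]
    simp only [conj_trivial]
    field_simp
    ring
  rw [jbracket, key, Real.sqrt_sq]
  have := jbracket_pos x
  have := jbracket_pos y
  positivity

theorem abs_det_smul_reflection (K : Submodule ℝ (EuclideanSpace ℝ (Fin n))) (c : ℝ) (hc : 0 ≤ c) :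
    |(c • (K.reflection : EuclideanSpace ℝ (Fin n) →L[ℝ] EuclideanSpace ℝ (Fin n))).det|
      = c ^ n := by
  rw [ContinuousLinearMap.det, ContinuousLinearMap.toLinearMap_smul, LinearMap.det_smul, abs_mul]
  have : LinearMap.det
      ((K.reflection : EuclideanSpace ℝ (Fin n) →L[ℝ] EuclideanSpace ℝ (Fin n)) :
        EuclideanSpace ℝ (Fin n) →ₗ[ℝ] EuclideanSpace ℝ (Fin n))
      = (-1) ^ Module.finrank ℝ Kᗮ := K.det_reflection
  rw [this]
  simp [abs_of_nonneg hc]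

theorem inversion_image_closedBall_diff (x : EuclideanSpace ℝ (Fin n)) {ρ ε : ℝ} (hρ : 0 < ρ)
    (hε : 0 < ε) :
    EuclideanGeometry.inversion x ρ '' (Metric.closedBall x (ρ ^ 2 / ε) \ {x})
      = (Metric.ball x ε)ᶜ := by
  rw [(EuclideanGeometry.inversion_involutive x hρ.ne').image_eq_preimage_symm]
  ext y
  simp only [mem_preimage, Set.mem_sdiff, Metric.mem_closedBall, mem_singleton_iff, mem_compl_iff,
    Metric.mem_ball, not_lt, EuclideanGeometry.dist_inversion_center,
    EuclideanGeometry.inversion_eq_center hρ.ne']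
  constructor
  · rintro ⟨h1, h2⟩
    exact (div_le_div_iff_of_pos_left (by positivity) (dist_pos.2 h2) hε).1 h1
  · intro h
    refine ⟨div_le_div_of_nonneg_left (by positivity) hε h, ?_⟩
    rintro rfl
    simp at h; linarith

/-- Among balls of a given radius, the one centred at the point of concentration carries the
largest integral of a function. -/
theorem setIntegral_closedBall_le {f : EuclideanSpace ℝ (Fin n) → ℝ} (hf : Continuous f)
    {M m : ℝ} (h1 : ∀ y, ‖y‖ ≤ M → m ≤ f y) (h2 : ∀ y, M < ‖y‖ → f y ≤ m)
    (x : EuclideanSpace ℝ (Fin n)) :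
    ∫ y in Metric.closedBall x M, f y ≤ ∫ y in Metric.closedBall 0 M, f y := by
  have hi : ∀ z, IntegrableOn f (Metric.closedBall z M) := fun z =>
    hf.continuousOn.integrableOn_compact (isCompact_closedBall z M)
  have hc : ∀ z, IntegrableOn (fun _ => m) (Metric.closedBall z M) (volume : Measure
      (EuclideanSpace ℝ (Fin n))) := fun z =>
    continuousOn_const.integrableOn_compact (isCompact_closedBall z M)
  -- Both balls have the same volume, so subtracting `m` is harmless. Afterwards the integrand is
  -- nonnegative on the centred ball and nonpositive off it, so the indicators compare pointwise.
  have key : ∫ y in Metric.closedBall x M, (f y - m) ≤ ∫ y in Metric.closedBall 0 M, (f y - m) := by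
    rw [← integral_indicator measurableSet_closedBall, ← integral_indicator measurableSet_closedBall]
    refine integral_mono (((hi x).sub (hc x)).integrable_indicator measurableSet_closedBall)
      (((hi 0).sub (hc 0)).integrable_indicator measurableSet_closedBall) fun y => ?_
    simp only [indicator, mem_closedBall_zero_iff]
    split_ifs with ha hb hb
    · exact le_rfl
    · exact sub_nonpos.2 (h2 y (not_le.1 hb))
    · exact sub_nonneg.2 (h1 y hb)
    · exact le_rfl
  rw [integral_sub (hi x) (hc x), integral_sub (hi 0) (hc 0), setIntegral_const, setIntegral_const,
    measureReal_def, measureReal_def, Measure.addHaar_closedBall_center] at key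
  linarith

theorem continuous_inv_jbracket_rpow (p : ℝ) :
    Continuous fun y : EuclideanSpace ℝ (Fin n) => (jbracket y ^ p)⁻¹ :=
  (continuous_jbracket.rpow_const fun y => Or.inl (jbracket_pos y).ne').inv₀
    fun y => (Real.rpow_pos_of_pos (jbracket_pos y) p).ne'

/-- The Talenti bubble `⟨x⟩^{-(n-2s)}` is `s`-superharmonic, in the strong sense that all its
truncated singular integrals are nonnegative. -/
theorem truncFracLap_bubble_nonneg (hs0 : 0 < s) (hn : 2 * s < n) (x : EuclideanSpace ℝ (Fin n))
    {ε : ℝ} (hε : 0 < ε) :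
    0 ≤ truncFracLap s (fun y => (jbracket y ^ ((n : ℝ) - 2 * s))⁻¹) x ε := by
  set N : ℝ := (n : ℝ) - 2 * s with hN
  have hN0 : 0 < N := by linarith
  set U : EuclideanSpace ℝ (Fin n) → ℝ := fun y => (jbracket y ^ N)⁻¹ with hU
  have hUc : Continuous U := continuous_inv_jbracket_rpow N
  have hUpos : ∀ y, 0 < U y := fun y => inv_pos.2 (Real.rpow_pos_of_pos (jbracket_pos y) N)
  have hU1 : ∀ y, |U y| ≤ 1 := fun y => by
    rw [abs_of_pos (hUpos y)]
    exact inv_le_one_of_one_le₀ (Real.one_le_rpow (one_le_jbracket y) hN0.le)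
  set ρ := jbracket x with hρ
  have hρ0 : 0 < ρ := jbracket_pos x
  set M := ρ ^ 2 / ε with hM
  set B := Metric.closedBall x M \ {x} with hB
  have hBm : MeasurableSet B := measurableSet_closedBall.diff (measurableSet_singleton x)
  set D := fun y : EuclideanSpace ℝ (Fin n) => (ρ / dist y x) ^ 2 •
    ((ℝ ∙ (y - x))ᗮ.reflection : EuclideanSpace ℝ (Fin n) →L[ℝ] EuclideanSpace ℝ (Fin n)) with hD
  have hD' : ∀ y ∈ B, HasFDerivWithinAt (EuclideanGeometry.inversion x ρ) (D y) B y := fun y hy =>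
    (EuclideanGeometry.hasFDerivAt_inversion hy.2).hasFDerivWithinAt
  have hinj : InjOn (EuclideanGeometry.inversion x ρ) B :=
    (EuclideanGeometry.inversion_injective x hρ0.ne').injOn
  have himg := inversion_image_closedBall_diff x hρ0 hε
  set f := fun y => (U x - U y) / ‖x - y‖ ^ ((n : ℝ) + 2 * s) with hf
  have hint : IntegrableOn f (Metric.ball x ε)ᶜ :=
    integrableOn_truncFracLap hs0 hUc.measurable hU1 x hε
  -- With `d = dist y x`, the Jacobian is `(ρ/d)^{2n}`, the kernel `(d/ρ²)^{n+2s}`, and the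
  -- difference of values `ρ^{-N}(1 - d^N U(y))`. Since `2n = N + (n + 2s)`, the powers of `d`
  -- collapse to `d^{-N}`, and `c` collects the powers of `ρ`.
  set c : ℝ := ρ ^ (2 * n : ℝ) * ρ ^ (-N) / ρ ^ (2 * ((n : ℝ) + 2 * s)) with hc
  have hc0 : 0 < c := by positivity
  have hpt : ∀ y ∈ B, |(D y).det| • f (EuclideanGeometry.inversion x ρ y)
      = c * ((dist y x ^ N)⁻¹ - U y) := by
    intro y hy
    have hd : 0 < dist y x := dist_pos.2 hy.2
    have hjy := jbracket_pos y
    have h1 : ‖x - EuclideanGeometry.inversion x ρ y‖ = ρ ^ 2 / dist y x := by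
      rw [← dist_eq_norm, EuclideanGeometry.dist_center_inversion, dist_comm]
    rw [hD, abs_det_smul_reflection _ _ (by positivity), smul_eq_mul]
    simp only [hf, hU, h1]
    rw [hρ, jbracket_inversion hy.2, ← hρ]
    rw [Real.div_rpow (by positivity) hd.le, Real.mul_rpow hρ0.le hjy.le,
      Real.div_rpow (by positivity) hd.le, hc, Real.rpow_neg hρ0.le]
    have e1 : ((ρ / dist y x) ^ 2) ^ n = ρ ^ (2 * n : ℝ) / dist y x ^ (2 * n : ℝ) := by
      rw [← pow_mul, div_pow, ← Real.rpow_natCast, ← Real.rpow_natCast]; push_cast; rfl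
    have e2 : (ρ ^ 2) ^ ((n : ℝ) + 2 * s) = ρ ^ (2 * ((n : ℝ) + 2 * s)) := by
      rw [← Real.rpow_natCast, ← Real.rpow_mul hρ0.le]; push_cast; rfl
    have e3 : dist y x ^ (2 * n : ℝ) = dist y x ^ N * dist y x ^ ((n : ℝ) + 2 * s) := by
      rw [← Real.rpow_add hd]; congr 1; rw [hN]; ring
    rw [e1, e2, e3]
    field_simp
  have hintB : IntegrableOn (fun y => c * ((dist y x ^ N)⁻¹ - U y)) B := by
    rw [← himg, integrableOn_image_iff_integrableOn_abs_det_fderiv_smul volume hBm hD' hinj] at hint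
    exact hint.congr_fun hpt hBm
  have hval : truncFracLap s U x ε = c * ∫ y in B, ((dist y x ^ N)⁻¹ - U y) := by
    rw [truncFracLap, ← himg,
      integral_image_eq_integral_abs_det_fderiv_smul volume hBm hD' hinj,
      setIntegral_congr_fun hBm hpt, integral_const_mul]
  rw [hval]
  refine mul_nonneg hc0.le ?_
  have hUB : ∀ z, IntegrableOn U (Metric.closedBall z M) := fun z =>
    hUc.continuousOn.integrableOn_compact (isCompact_closedBall z M)
  have hUB' : IntegrableOn U B := (hUB x).mono_set sdiff_subset
  have hdB : IntegrableOn (fun y => (dist y x ^ N)⁻¹) B := by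
    refine IntegrableOn.congr_fun ((hintB.const_mul c⁻¹).add hUB') (fun y _ => ?_) hBm
    simp only [Pi.add_apply]
    field_simp
    ring
  have hVB : IntegrableOn (fun y => U (y - x)) (Metric.closedBall x M) :=
    (hUc.comp (continuous_id.sub continuous_const)).continuousOn.integrableOn_compact
      (isCompact_closedBall x M)
  rw [integral_sub hdB hUB', sub_nonneg]
  -- Moving the ball to the origin can only increase the integral of the radially decreasing `U`.
  -- Translating back leaves `U(y - x) ≤ |y - x|^{-N}`.
  calc ∫ y in B, U y ≤ ∫ y in Metric.closedBall x M, U y :=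
        setIntegral_mono_set (hUB x) (Eventually.of_forall fun y => (hUpos y).le)
          sdiff_subset.eventuallyLE
    _ ≤ ∫ y in Metric.closedBall 0 M, U y := by
        refine setIntegral_closedBall_le (m := (Real.sqrt (1 + M ^ 2) ^ N)⁻¹) hUc
          (fun y hy => ?_) (fun y hy => ?_) x
        · have := jbracket_pos y
          have : jbracket y ≤ Real.sqrt (1 + M ^ 2) := Real.sqrt_le_sqrt (by gcongr)
          simp only [hU]
          gcongr
        · have : Real.sqrt (1 + M ^ 2) ≤ jbracket y := Real.sqrt_le_sqrt (by gcongr)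
          simp only [hU]
          gcongr
    _ = ∫ y in Metric.closedBall x M, U (y - x) := by
        rw [← integral_indicator measurableSet_closedBall,
          ← integral_indicator measurableSet_closedBall, ← integral_sub_right_eq_self _ x]
        refine integral_congr_ae (Eventually.of_forall fun y => ?_)
        simp [indicator, dist_eq_norm]
    _ = ∫ y in B, U (y - x) := by
        have : Nonempty (Fin n) := Fin.pos_iff_nonempty.1 (by
          rw [Nat.pos_iff_ne_zero]; rintro rfl; simp at hn; linarith)
        exact setIntegral_congr_set (sdiff_null_ae_eq_self (measure_singleton x)).symm
    _ ≤ ∫ y in B, (dist y x ^ N)⁻¹ := by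
        refine setIntegral_mono_on (hVB.mono_set sdiff_subset) hdB hBm fun y hy => ?_
        have hd : 0 < dist y x := dist_pos.2 hy.2
        have : dist y x ≤ jbracket (y - x) := by
          rw [dist_eq_norm]; exact norm_le_jbracket _
        simp only [hU]
        gcongr

end Positivity

/-! ### Concavity relative to the bubble, and the lower bound from the tail -/

section Concavity

variable {n : ℕ} {s : ℝ}

/-- `smoothMin μ` lies below its tangent planes, which have nonnegative slopes and pass through the
origin. -/
theorem smoothMin_tangent {μ a b : ℝ} (hμ0 : 0 < μ) (hμ1 : μ < 1 / 2) (ha : 0 < a) (hb : 0 < b) :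
    ∃ D₁ D₂ : ℝ, 0 ≤ D₁ ∧ 0 ≤ D₂ ∧ smoothMin μ a b = D₁ * a + D₂ * b ∧
      ∀ a' b', smoothMin μ a' b' ≤ D₁ * a' + D₂ * b' := by
  have hab : 0 < μ * a * b := by positivity
  have hQ : 0 < ((a - b) / 2) ^ 2 + μ * a * b := by positivity
  set S := Real.sqrt (((a - b) / 2) ^ 2 + μ * a * b) with hS
  have hS0 : 0 < S := Real.sqrt_pos.2 hQ
  have hSsq : S ^ 2 = ((a - b) / 2) ^ 2 + μ * a * b := Real.sq_sqrt hQ.le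
  -- The two slopes are the partial derivatives of `F`. Their sign comes from `S² - ((c - (1 -
  -- 2μ)d)/2)² = μ(1 - μ)d²`.
  have slope : ∀ c d : ℝ, S ^ 2 = ((c - d) / 2) ^ 2 + μ * c * d →
      0 ≤ 1 / 2 - (c / 4 - (1 - 2 * μ) * d / 4) / S := by
    intro c d h
    rw [sub_nonneg, div_le_iff₀ hS0]
    refine le_of_sq_le_sq ?_ (by positivity)
    nlinarith [mul_nonneg (mul_nonneg hμ0.le (by linarith : 0 ≤ 1 - μ)) (sq_nonneg d)]
  refine ⟨_, _, slope a b hSsq, slope b a (by rw [hSsq]; ring), ?_, fun a' b' => ?_⟩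
  · rw [smoothMin, ← hS]
    field_simp
    linear_combination (-8) * hSsq
  -- Cauchy-Schwarz for the quadratic form under the root, whose determinant is `μ(1 - μ)/4`. Thus
  -- `F` is a linear function minus a norm.
  · have hCS : (a / 4 - (1 - 2 * μ) * b / 4) * a' + (b / 4 - (1 - 2 * μ) * a / 4) * b'
        ≤ S * Real.sqrt (((a' - b') / 2) ^ 2 + μ * a' * b') := by
      rw [hS, ← Real.sqrt_mul hQ.le]
      refine (le_abs_self _).trans (Real.abs_le_sqrt ?_)
      have : 0 ≤ μ * (1 - μ) / 4 * (a * b' - a' * b) ^ 2 :=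
        mul_nonneg (by nlinarith) (sq_nonneg _)
      nlinarith
    have : ((a / 4 - (1 - 2 * μ) * b / 4) * a' + (b / 4 - (1 - 2 * μ) * a / 4) * b') / S
        ≤ Real.sqrt (((a' - b') / 2) ^ 2 + μ * a' * b') := by
      rwa [div_le_iff₀' hS0]
    rw [smoothMin]
    have e : (1 / 2 - (a / 4 - (1 - 2 * μ) * b / 4) / S) * a'
        + (1 / 2 - (b / 4 - (1 - 2 * μ) * a / 4) / S) * b'
        = (a' + b') / 2
          - ((a / 4 - (1 - 2 * μ) * b / 4) * a' + (b / 4 - (1 - 2 * μ) * a / 4) * b') / S := by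
      ring
    linarith

theorem smoothMin_nonneg {μ a b : ℝ} (hμ0 : 0 < μ) (hμ1 : μ < 1 / 2) (ha : 0 < a) (hb : 0 < b) :
    0 ≤ smoothMin μ a b := by
  obtain ⟨D₁, D₂, h1, h2, h, -⟩ := smoothMin_tangent hμ0 hμ1 ha hb
  rw [h]
  positivity

theorem smoothMin_mul {μ t : ℝ} (ht : 0 ≤ t) (a b : ℝ) :
    smoothMin μ (t * a) (t * b) = t * smoothMin μ a b := by
  have : ((t * a - t * b) / 2) ^ 2 + μ * (t * a) * (t * b)
      = t ^ 2 * (((a - b) / 2) ^ 2 + μ * a * b) := by ring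
  rw [smoothMin, smoothMin, this, Real.sqrt_mul (sq_nonneg t), Real.sqrt_sq ht]
  ring

/-- `w` lies below a multiple of the bubble `⟨y⟩^{-(n-2s)}` touching it at `x`, with a gap of size
`c * w x` off the ball of radius `K⟨x⟩`. -/
def IsBubbleConcaveAt (s c K : ℝ) (w : EuclideanSpace ℝ (Fin n) → ℝ)
    (x : EuclideanSpace ℝ (Fin n)) : Prop :=
  ∃ A : ℝ, 0 ≤ A ∧ ∀ y, A * ((jbracket x ^ ((n : ℝ) - 2 * s))⁻¹
      - (jbracket y ^ ((n : ℝ) - 2 * s))⁻¹)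
    + (Metric.ball 0 (K * jbracket x))ᶜ.indicator (fun _ => c * w x) y ≤ w x - w y

theorem isBubbleConcaveAt_inv_jbracket_rpow {p c : ℝ} (hp : 0 < p) (hpn : p < (n : ℝ) - 2 * s)
    (hc0 : 0 < c) (hc : 2 * c ≤ 1 - p / ((n : ℝ) - 2 * s)) {K : ℝ} (hK0 : 0 < K)
    (hK : c⁻¹ ≤ K ^ p) (x : EuclideanSpace ℝ (Fin n)) :
    IsBubbleConcaveAt s c K (fun y => (jbracket y ^ p)⁻¹) x := by
  set N := (n : ℝ) - 2 * s with hN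
  have hN0 : 0 < N := hp.trans hpn
  have hx := jbracket_pos x
  -- The slope is the derivative of `t ↦ t^{p/N}` at `t = U(x)`. Below, `q = U(y)/U(x)`.
  refine ⟨p / N * ((jbracket x ^ p)⁻¹ * jbracket x ^ N), by positivity, fun y => ?_⟩
  have hy := jbracket_pos y
  set q := jbracket x ^ N / jbracket y ^ N with hq
  have hq0 : 0 < q := by positivity
  have hqp : q ^ (p / N) = jbracket x ^ p / jbracket y ^ p := by
    rw [hq, ← Real.div_rpow hx.le hy.le, ← Real.rpow_mul (by positivity), mul_div_cancel₀ _ hN0.ne',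
      Real.div_rpow hx.le hy.le]
  have hθ1 : p / N ≤ 1 := by rw [div_le_one hN0]; exact hpn.le
  have e1 : (jbracket x ^ p)⁻¹ - (jbracket y ^ p)⁻¹
      = (jbracket x ^ p)⁻¹ * (1 - q ^ (p / N)) := by
    rw [hqp]; field_simp
  have e2 : p / N * ((jbracket x ^ p)⁻¹ * jbracket x ^ N)
      * ((jbracket x ^ N)⁻¹ - (jbracket y ^ N)⁻¹)
      = (jbracket x ^ p)⁻¹ * (p / N * (1 - q)) := by
    rw [hq]; field_simp
  rw [e1, e2]
  -- Far out, `q^{p/N} ≤ c` and `2c ≤ 1 - p/N` leave room for the gap. Elsewhere the claim is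
  -- Bernoulli's inequality.
  by_cases h : y ∈ (Metric.ball (0 : EuclideanSpace ℝ (Fin n)) (K * jbracket x))ᶜ
  · rw [indicator_of_mem h, mul_comm c, ← mul_add]
    refine mul_le_mul_of_nonneg_left ?_ (by positivity)
    have h' : K * jbracket x ≤ jbracket y := by
      have : K * jbracket x ≤ ‖y‖ := by simpa using h
      exact this.trans (norm_le_jbracket y)
    have h1 : q ^ (p / N) ≤ c := by
      rw [hqp, div_le_iff₀ (by positivity)]
      calc jbracket x ^ p = c * (c⁻¹ * jbracket x ^ p) := by field_simp
        _ ≤ c * (K ^ p * jbracket x ^ p) := by gcongr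
        _ = c * (K * jbracket x) ^ p := by rw [Real.mul_rpow hK0.le hx.le]
        _ ≤ c * jbracket y ^ p := by gcongr
    have h2 : 0 ≤ p / N * q := by positivity
    linarith
  · rw [indicator_of_notMem h, add_zero]
    refine mul_le_mul_of_nonneg_left ?_ (by positivity)
    have := rpow_one_add_le_one_add_mul_self (s := q - 1) (by linarith)
      (p := p / N) (by positivity) hθ1
    rw [add_sub_cancel] at this
    linarith

variable {c K : ℝ} {w w₁ w₂ : EuclideanSpace ℝ (Fin n) → ℝ} {x : EuclideanSpace ℝ (Fin n)}

theorem IsBubbleConcaveAt.const_mul (h : IsBubbleConcaveAt s c K w x) {t : ℝ} (ht : 0 ≤ t) :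
    IsBubbleConcaveAt s c K (fun y => t * w y) x := by
  obtain ⟨A, hA, h⟩ := h
  refine ⟨t * A, by positivity, fun y => ?_⟩
  have e : (Metric.ball 0 (K * jbracket x))ᶜ.indicator (fun _ => c * (t * w x)) y
      = t * (Metric.ball 0 (K * jbracket x))ᶜ.indicator (fun _ => c * w x) y := by
    simp only [indicator]; split_ifs <;> ring
  rw [e, mul_assoc, ← mul_add, ← mul_sub]
  exact mul_le_mul_of_nonneg_left (h y) ht

/-- The tangent plane of `F` at `(w₁ x, w₂ x)` has nonnegative slopes, so the two inequalities can
be combined. It passes through the origin, so the two gaps add up to exactly `c` times the value of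
`F`. -/
theorem IsBubbleConcaveAt.smoothMin (h₁ : IsBubbleConcaveAt s c K w₁ x)
    (h₂ : IsBubbleConcaveAt s c K w₂ x) (hw₁ : 0 < w₁ x) (hw₂ : 0 < w₂ x) {μ : ℝ} (hμ0 : 0 < μ)
    (hμ1 : μ < 1 / 2) : IsBubbleConcaveAt s c K (fun y => smoothMin μ (w₁ y) (w₂ y)) x := by
  obtain ⟨A₁, hA₁, h₁⟩ := h₁
  obtain ⟨A₂, hA₂, h₂⟩ := h₂
  obtain ⟨D₁, D₂, hD₁, hD₂, he, hle⟩ := smoothMin_tangent hμ0 hμ1 hw₁ hw₂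
  refine ⟨D₁ * A₁ + D₂ * A₂, by positivity, fun y => ?_⟩
  have e : (Metric.ball 0 (K * jbracket x))ᶜ.indicator
        (fun _ => c * _root_.smoothMin μ (w₁ x) (w₂ x)) y
      = D₁ * (Metric.ball 0 (K * jbracket x))ᶜ.indicator (fun _ => c * w₁ x) y
        + D₂ * (Metric.ball 0 (K * jbracket x))ᶜ.indicator (fun _ => c * w₂ x) y := by
    simp only [indicator, he]; split_ifs <;> ring
  have k₁ := mul_le_mul_of_nonneg_left (h₁ y) hD₁
  have k₂ := mul_le_mul_of_nonneg_left (h₂ y) hD₂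
  have k := hle (w₁ y) (w₂ y)
  rw [e]
  simp only [he]
  linarith

/-- The cut-off keeps the value at `x` and can only lower the nonnegative function elsewhere. -/
theorem IsBubbleConcaveAt.indicator (h : IsBubbleConcaveAt s c K w x)
    {S : Set (EuclideanSpace ℝ (Fin n))} (hS : x ∈ S) (hw : ∀ y, 0 ≤ w y) :
    IsBubbleConcaveAt s c K (S.indicator w) x := by
  obtain ⟨A, hA, h⟩ := h
  refine ⟨A, hA, fun y => ?_⟩
  rw [indicator_of_mem hS]
  have := indicator_le_self' (s := S) (f := w) (fun y _ => hw y) y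
  linarith [h y]

/-- The mass of the kernel `(2|y|)^{-(n+2s)}` off the ball of radius `K`. -/
noncomputable def tailMass (n : ℕ) (s K : ℝ) : ℝ :=
  ∫ y in (Metric.ball (0 : EuclideanSpace ℝ (Fin n)) K)ᶜ, ((2 * ‖y‖) ^ ((n : ℝ) + 2 * s))⁻¹

theorem integrableOn_tailMass (hs : 0 < s) (hK : 0 < K) :
    IntegrableOn (fun y : EuclideanSpace ℝ (Fin n) => ((2 * ‖y‖) ^ ((n : ℝ) + 2 * s))⁻¹)
      (Metric.ball 0 K)ᶜ := by
  refine ((integrableOn_compl_ball_norm_sub_rpow_inv (n := n) hs 0 hK).const_mul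
    (2 ^ ((n : ℝ) + 2 * s))⁻¹).congr (Eventually.of_forall fun y => ?_)
  simp only [zero_sub, norm_neg]
  rw [Real.mul_rpow (by norm_num) (norm_nonneg _), mul_inv]

theorem tailMass_pos (hn : 1 ≤ n) (hs : 0 < s) (hK : 0 < K) : 0 < tailMass n s K := by
  have : Nonempty (Fin n) := Fin.pos_iff_nonempty.1 hn
  refine (setIntegral_pos_iff_support_of_nonneg_ae (Eventually.of_forall fun y => ?_)
    (integrableOn_tailMass hs hK)).2 ?_
  · simp only [Pi.zero_apply]; positivity
  · have hsub : (Metric.closedBall (0 : EuclideanSpace ℝ (Fin n)) K)ᶜ ⊆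
        Function.support (fun y : EuclideanSpace ℝ (Fin n) =>
          ((2 * ‖y‖) ^ ((n : ℝ) + 2 * s))⁻¹) ∩ (Metric.ball 0 K)ᶜ := by
      intro y hy
      have hy' : K < ‖y‖ := by simpa using hy
      have : 0 < ‖y‖ := hK.trans hy'
      refine ⟨?_, by simpa using hy'.le⟩
      rw [Function.mem_support]
      positivity
    refine lt_of_lt_of_le ?_ (measure_mono hsub)
    refine Metric.isClosed_closedBall.isOpen_compl.measure_pos _ ?_
    obtain ⟨v, hv⟩ := NormedSpace.exists_lt_norm ℝ (EuclideanSpace ℝ (Fin n)) K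
    exact ⟨v, by simpa using hv⟩

theorem setIntegral_tail_eq {r : ℝ} (hr : 0 < r) :
    ∫ y in (Metric.ball (0 : EuclideanSpace ℝ (Fin n)) (K * r))ᶜ,
      ((2 * ‖y‖) ^ ((n : ℝ) + 2 * s))⁻¹ = (r ^ (2 * s))⁻¹ * tailMass n s K := by
  have h := Measure.setIntegral_comp_smul_of_pos (volume : Measure (EuclideanSpace ℝ (Fin n)))
    (fun y => ((2 * ‖y‖) ^ ((n : ℝ) + 2 * s))⁻¹) (Metric.ball 0 K)ᶜ hr
  rw [Set.compl_eq_univ_sdiff, Set.smul_set_sdiff₀ hr.ne', Set.smul_set_univ₀ hr.ne',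
    ← Set.compl_eq_univ_sdiff, ← Set.compl_eq_univ_sdiff, smul_ball hr.ne', smul_zero,
    Real.norm_of_nonneg hr.le, mul_comm r, smul_eq_mul, finrank_euclideanSpace_fin] at h
  rw [eq_inv_mul_iff_mul_eq₀ (by positivity)] at h
  rw [← h, tailMass]
  simp_rw [norm_smul, Real.norm_of_nonneg hr.le]
  rw [← integral_const_mul, ← integral_const_mul]
  refine integral_congr_ae (Eventually.of_forall fun y => ?_)
  simp only
  rw [mul_left_comm, Real.mul_rpow hr.le (by positivity), Real.rpow_add hr, Real.rpow_natCast]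
  field_simp

theorem IsBubbleConcaveAt.le_truncFracLap (h : IsBubbleConcaveAt s c K w x) (hs0 : 0 < s)
    (hn : 2 * s < n) (hw : Measurable w) {C : ℝ} (hC : ∀ y, |w y| ≤ C) (hcw : 0 ≤ c * w x)
    (hK : 2 ≤ K) {ε : ℝ} (hε : 0 < ε) (hεx : ε ≤ jbracket x) :
    c * tailMass n s K * (w x * (jbracket x ^ (2 * s))⁻¹) ≤ truncFracLap s w x ε := by
  obtain ⟨A, hA, h⟩ := h
  have hx := jbracket_pos x
  have hU := truncFracLap_bubble_nonneg hs0 hn x hε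
  have hUint := integrableOn_truncFracLap hs0
    (continuous_inv_jbracket_rpow (n := n) ((n : ℝ) - 2 * s)).measurable (C := 1) (fun y => by
      have := jbracket_pos y
      rw [abs_of_nonneg (by positivity)]
      exact inv_le_one_of_one_le₀ (Real.one_le_rpow (one_le_jbracket y) (by linarith))) x hε
  have hwint := integrableOn_truncFracLap hs0 hw hC x hε
  set S := (Metric.ball (0 : EuclideanSpace ℝ (Fin n)) (K * jbracket x))ᶜ with hS
  have hSm : MeasurableSet S := measurableSet_ball.compl
  have hSK : ∀ y ∈ S, K * jbracket x ≤ ‖y‖ := fun y hy => by simpa [hS] using hy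
  -- Here `|y - x| ≥ K⟨x⟩ - |x| ≥ ⟨x⟩ ≥ ε`, by `K ≥ 2`, so the truncation does not cut the tail
  -- region.
  have hSε : S ⊆ (Metric.ball x ε)ᶜ := by
    intro y hy
    have h1 := hSK y hy
    have h2 := norm_sub_norm_le y x
    have h3 := norm_le_jbracket x
    simp only [mem_compl_iff, Metric.mem_ball, not_lt, dist_eq_norm]
    nlinarith
  set g := fun y => S.indicator (fun y => c * w x * ((2 * ‖y‖) ^ ((n : ℝ) + 2 * s))⁻¹) y
  have hgint : IntegrableOn g (Metric.ball x ε)ᶜ := by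
    refine Integrable.integrableOn ?_
    rw [integrable_indicator_iff hSm]
    exact (integrableOn_tailMass hs0 (by positivity)).const_mul _
  have hgval : ∫ y in (Metric.ball x ε)ᶜ, g y
      = c * tailMass n s K * (w x * (jbracket x ^ (2 * s))⁻¹) := by
    rw [setIntegral_indicator hSm, inter_eq_self_of_subset_right hSε, integral_const_mul,
      setIntegral_tail_eq hx]
    ring
  have hmono := setIntegral_mono_on ((hUint.const_mul A).add hgint) hwint
    measurableSet_ball.compl fun y hy => ?_
  · simp only [Pi.add_apply] at hmono
    rw [integral_add (hUint.const_mul A) hgint, integral_const_mul, hgval] at hmono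
    have := mul_nonneg hA hU
    rw [truncFracLap] at this ⊢
    linarith
  · have hd : 0 < ‖x - y‖ := by
      have : ε ≤ ‖y - x‖ := by simpa [dist_eq_norm] using hy
      rw [norm_sub_rev]
      linarith
    simp only [Pi.add_apply]
    rw [le_div_iff₀ (by positivity), add_mul, mul_assoc, div_mul_cancel₀ _ (by positivity)]
    refine le_trans (add_le_add_right ?_ _) (h y)
    by_cases hyS : y ∈ S
    · have h1 := hSK y hyS
      -- Since `|x| ≤ ⟨x⟩ ≤ |y|` on the tail, the kernel there dominates `(2|y|)^{-(n+2s)}`.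
      have h4 : ‖x - y‖ ≤ 2 * ‖y‖ := by
        have h2 := norm_sub_le x y
        have h3 := norm_le_jbracket x
        nlinarith
      simp only [g, indicator_of_mem hyS]
      rw [mul_assoc]
      refine mul_le_of_le_one_right hcw ?_
      rw [inv_mul_le_iff₀ (Real.rpow_pos_of_pos (by linarith) _), mul_one]
      exact Real.rpow_le_rpow hd.le h4 (by positivity)
    · simp [g, indicator_of_notMem hyS]

theorem truncFracLap_comp_bubbleCoord (u : EuclideanSpace ℝ (Fin n) → ℝ) {l : ℝ} (hl : 0 < l)
    (z x : EuclideanSpace ℝ (Fin n)) (ε : ℝ) :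
    truncFracLap s (fun y => u (bubbleCoord l z y)) x ε
      = l ^ (2 * s) * truncFracLap s u (bubbleCoord l z x) (l * ε) := by
  set x' := bubbleCoord l z x with hx'
  set G := (Metric.ball x' (l * ε))ᶜ.indicator
    (fun y => (u x' - u y) / ‖x' - y‖ ^ ((n : ℝ) + 2 * s)) with hG
  have hdist : ∀ y, ‖x' - l • (y - z)‖ = l * ‖x - y‖ := fun y => by
    rw [hx', bubbleCoord, ← smul_sub, norm_smul, Real.norm_of_nonneg hl.le]
    congr 2; abel
  have h1 : ∫ y, G (l • (y - z)) = (l ^ n)⁻¹ * ∫ y, G y := by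
    rw [integral_sub_right_eq_self (fun y => G (l • y)) z, Measure.integral_comp_smul_of_nonneg
      _ _ _ (hR := hl.le), finrank_euclideanSpace_fin, smul_eq_mul]
  have h2 : ∀ y, (Metric.ball x ε)ᶜ.indicator
      (fun y => (u x' - u (l • (y - z))) / ‖x - y‖ ^ ((n : ℝ) + 2 * s)) y
      = l ^ ((n : ℝ) + 2 * s) * G (l • (y - z)) := by
    intro y
    have hmem : l • (y - z) ∈ (Metric.ball x' (l * ε))ᶜ ↔ y ∈ (Metric.ball x ε)ᶜ := by
      simp only [mem_compl_iff, Metric.mem_ball, not_lt]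
      rw [dist_comm, dist_comm y, dist_eq_norm, dist_eq_norm, hdist, mul_le_mul_iff_right₀ hl]
    by_cases hy : y ∈ (Metric.ball x ε)ᶜ
    · rw [hG, indicator_of_mem (hmem.2 hy), indicator_of_mem hy, hdist,
        Real.mul_rpow hl.le (norm_nonneg _)]
      have := (Real.rpow_pos_of_pos hl ((n : ℝ) + 2 * s)).ne'
      rw [mul_div_assoc', mul_div_mul_left _ _ this]
    · rw [hG, indicator_of_notMem (mt hmem.1 hy), indicator_of_notMem hy, mul_zero]
  rw [truncFracLap, truncFracLap, ← integral_indicator measurableSet_ball.compl,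
    ← integral_indicator measurableSet_ball.compl]
  refine (integral_congr_ae (Eventually.of_forall h2)).trans ?_
  rw [integral_const_mul, h1, ← mul_assoc, ← hG]
  congr 1
  rw [Real.rpow_add hl, Real.rpow_natCast]
  field_simp

theorem IsBubbleConcaveAt.eventually_le_truncFracLap {l : ℝ} {z : EuclideanSpace ℝ (Fin n)}
    (h : IsBubbleConcaveAt s c K w (bubbleCoord l z x)) (hl : 0 < l) (hs0 : 0 < s)
    (hn : 2 * s < n) (hw : Measurable w) {C : ℝ} (hC : ∀ y, |w y| ≤ C)
    (hcw : 0 ≤ c * w (bubbleCoord l z x)) (hK : 2 ≤ K) :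
    ∀ᶠ ε in 𝓝[>] 0, c * tailMass n s K * (l ^ (2 * s) *
        (w (bubbleCoord l z x) * (jbracket (bubbleCoord l z x) ^ (2 * s))⁻¹))
      ≤ truncFracLap s (fun y => w (bubbleCoord l z y)) x ε := by
  have : ∀ᶠ ε : ℝ in 𝓝[>] 0, ε < jbracket (bubbleCoord l z x) / l :=
    eventually_nhdsWithin_of_eventually_nhds
      (eventually_lt_nhds (div_pos (jbracket_pos _) hl))
  filter_upwards [this, self_mem_nhdsWithin] with ε h1 h2
  rw [lt_div_iff₀' hl] at h1
  rw [truncFracLap_comp_bubbleCoord w hl, mul_left_comm]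
  exact mul_le_mul_of_nonneg_left
    (h.le_truncFracLap hs0 hn hw hC hcw hK (mul_pos hl h2) h1.le) (by positivity)

end Concavity

/-! ### Supersolution bounds for the individual weights and their sums -/

section Supersolutions

variable {n : ℕ} {s β v v₁ v₂ : ℝ} {f f₁ f₂ w : EuclideanSpace ℝ (Fin n) → ℝ}
  {x : EuclideanSpace ℝ (Fin n)}

theorem fracLapConst_pos (n : ℕ) (hs0 : 0 < s) (hs1 : s < 1) : 0 < fracLapConst n s := by
  have h1 : 0 < Real.Gamma ((n : ℝ) / 2 + s) := Real.Gamma_pos_of_pos (by positivity)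
  have h2 : 0 < Real.Gamma (1 - s) := Real.Gamma_pos_of_pos (by linarith)
  have := Real.pi_pos
  rw [fracLapConst]
  positivity

/-- `f` is bounded and measurable, twice continuously differentiable at `x`, and its truncated
singular integrals at `x` are eventually at least `β * v`. -/
structure IsTruncSupersolutionAt (s β : ℝ) (f : EuclideanSpace ℝ (Fin n) → ℝ)
    (x : EuclideanSpace ℝ (Fin n)) (v : ℝ) : Prop where
  measurable : Measurable f
  bounded : ∃ C, ∀ y, |f y| ≤ C
  contDiffAt : ContDiffAt ℝ 2 f x
  eventually_le : ∀ᶠ ε in 𝓝[>] 0, β * v ≤ truncFracLap s f x ε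

namespace IsTruncSupersolutionAt

theorem exists_hasFracLaplacianAt (h : IsTruncSupersolutionAt s β f x v) (hn : 1 ≤ n)
    (hs0 : 0 < s) (hs1 : s < 1) :
    ∃ L, HasFracLaplacianAt s f x L ∧ fracLapConst n s * β * v ≤ L := by
  obtain ⟨C, hC⟩ := h.bounded
  obtain ⟨L, hL⟩ := _root_.exists_hasFracLaplacianAt hn hs0 hs1 h.measurable hC h.contDiffAt
  refine ⟨L, hL, ge_of_tendsto hL.2 ?_⟩
  filter_upwards [h.eventually_le] with ε hε
  rw [mul_assoc]
  exact mul_le_mul_of_nonneg_left hε (fracLapConst_pos n hs0 hs1).le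

theorem zero : IsTruncSupersolutionAt s β (fun _ => 0) x 0 where
  measurable := measurable_const
  bounded := ⟨0, by simp⟩
  contDiffAt := contDiffAt_const
  eventually_le := Eventually.of_forall fun ε => by simp [truncFracLap]

theorem add (hs0 : 0 < s) (h₁ : IsTruncSupersolutionAt s β f₁ x v₁)
    (h₂ : IsTruncSupersolutionAt s β f₂ x v₂) :
    IsTruncSupersolutionAt s β (fun y => f₁ y + f₂ y) x (v₁ + v₂) where
  measurable := h₁.measurable.add h₂.measurable
  bounded := by
    obtain ⟨C₁, hC₁⟩ := h₁.bounded
    obtain ⟨C₂, hC₂⟩ := h₂.bounded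
    exact ⟨C₁ + C₂, fun y => (abs_add_le _ _).trans (add_le_add (hC₁ y) (hC₂ y))⟩
  contDiffAt := h₁.contDiffAt.add h₂.contDiffAt
  eventually_le := by
    obtain ⟨C₁, hC₁⟩ := h₁.bounded
    obtain ⟨C₂, hC₂⟩ := h₂.bounded
    filter_upwards [h₁.eventually_le, h₂.eventually_le, self_mem_nhdsWithin] with ε e₁ e₂ hε
    have : truncFracLap s (fun y => f₁ y + f₂ y) x ε
        = truncFracLap s f₁ x ε + truncFracLap s f₂ x ε := by
      rw [truncFracLap, truncFracLap, truncFracLap,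
        ← integral_add (integrableOn_truncFracLap hs0 h₁.measurable hC₁ x hε)
          (integrableOn_truncFracLap hs0 h₂.measurable hC₂ x hε)]
      congr 1
      ext y
      ring
    rw [this, mul_add]
    exact add_le_add e₁ e₂

theorem sum (hs0 : 0 < s) {ι : Type*} (J : Finset ι) {F : ι → EuclideanSpace ℝ (Fin n) → ℝ}
    {V : ι → ℝ} (h : ∀ j ∈ J, IsTruncSupersolutionAt s β (F j) x (V j)) :
    IsTruncSupersolutionAt s β (fun y => ∑ j ∈ J, F j y) x (∑ j ∈ J, V j) := by
  classical
  induction J using Finset.induction_on with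
  | empty => simpa using zero
  | insert a J ha ih =>
    simp_rw [Finset.sum_insert ha]
    exact add hs0 (h a (Finset.mem_insert_self a J))
      (ih fun j hj => h j (Finset.mem_insert_of_mem hj))

end IsTruncSupersolutionAt

theorem contDiff_bubbleCoord (l : ℝ) (z : EuclideanSpace ℝ (Fin n)) {m : WithTop ℕ∞} :
    ContDiff ℝ m (bubbleCoord l z) :=
  (contDiff_id.sub contDiff_const).const_smul l

theorem IsBubbleConcaveAt.isTruncSupersolutionAt {c K l : ℝ} {z : EuclideanSpace ℝ (Fin n)}
    (h : IsBubbleConcaveAt s c K w (bubbleCoord l z x)) (hl : 0 < l) (hs0 : 0 < s)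
    (hn : 2 * s < n) (hw : Measurable w) (hC : ∃ C, ∀ y, |w y| ≤ C)
    (hd : ContDiffAt ℝ 2 w (bubbleCoord l z x)) (hc : 0 ≤ c)
    (hw0 : 0 ≤ w (bubbleCoord l z x)) (hK : 2 ≤ K) :
    IsTruncSupersolutionAt s (c * tailMass n s K) (fun y => w (bubbleCoord l z y)) x
      (l ^ (2 * s) * (w (bubbleCoord l z x) * (jbracket (bubbleCoord l z x) ^ (2 * s))⁻¹)) where
  measurable := hw.comp (contDiff_bubbleCoord (m := 0) l z).continuous.measurable
  bounded := by
    obtain ⟨C, hC⟩ := hC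
    exact ⟨C, fun y => hC _⟩
  contDiffAt := ContDiffAt.comp x hd (contDiff_bubbleCoord l z).contDiffAt
  eventually_le := by
    obtain ⟨C, hC⟩ := hC
    exact h.eventually_le_truncFracLap hl hs0 hn hw hC (mul_nonneg hc hw0) hK

theorem contDiff_inv_jbracket_rpow (p : ℝ) {m : WithTop ℕ∞} :
    ContDiff ℝ m fun y : EuclideanSpace ℝ (Fin n) => (jbracket y ^ p)⁻¹ :=
  (contDiff_jbracket.rpow_const_of_ne fun y => (jbracket_pos y).ne').inv
    fun y => (Real.rpow_pos_of_pos (jbracket_pos y) p).ne'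

theorem inv_jbracket_rpow_pos (p : ℝ) (y : EuclideanSpace ℝ (Fin n)) : 0 < (jbracket y ^ p)⁻¹ :=
  inv_pos.2 (Real.rpow_pos_of_pos (jbracket_pos y) p)

theorem inv_jbracket_rpow_le_one {p : ℝ} (hp : 0 ≤ p) (y : EuclideanSpace ℝ (Fin n)) :
    (jbracket y ^ p)⁻¹ ≤ 1 :=
  inv_le_one_of_one_le₀ (Real.one_le_rpow (one_le_jbracket y) hp)

theorem smoothMin_le_half_add {μ a b : ℝ} : smoothMin μ a b ≤ (a + b) / 2 :=
  sub_le_self _ (Real.sqrt_nonneg _)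

theorem ContDiff.smoothMin {m : WithTop ℕ∞} {μ : ℝ} (hμ : 0 < μ) (h₁ : ContDiff ℝ m f₁)
    (h₂ : ContDiff ℝ m f₂) (hp₁ : ∀ y, 0 < f₁ y) (hp₂ : ∀ y, 0 < f₂ y) :
    ContDiff ℝ m fun y => smoothMin μ (f₁ y) (f₂ y) := by
  refine ((h₁.add h₂).div_const 2).sub (ContDiff.sqrt ((((h₁.sub h₂).div_const 2).pow 2).add
    ((contDiff_const.mul h₁).mul h₂)) fun y => ?_)
  have := hp₁ y
  have := hp₂ y
  positivity

/-- The constants entering the model inequality: the gap `c` and the threshold `K` work for both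
exponents `2s` and `n - 4s`. -/
theorem exists_isBubbleConcaveAt (hs0 : 0 < s) (hn : 4 * s < n) :
    ∃ c K : ℝ, 0 < c ∧ 2 ≤ K ∧
      (∀ x : EuclideanSpace ℝ (Fin n),
        IsBubbleConcaveAt s c K (fun y => (jbracket y ^ (2 * s))⁻¹) x) ∧
      ∀ x : EuclideanSpace ℝ (Fin n),
        IsBubbleConcaveAt s c K (fun y => (jbracket y ^ ((n : ℝ) - 4 * s))⁻¹) x := by
  have hN : 0 < (n : ℝ) - 2 * s := by linarith
  have hp1 : 0 < 2 * s := by linarith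
  have hp2 : 0 < (n : ℝ) - 4 * s := by linarith
  have h1 : 2 * s / ((n : ℝ) - 2 * s) < 1 := by rw [div_lt_one hN]; linarith
  have h2 : ((n : ℝ) - 4 * s) / ((n : ℝ) - 2 * s) < 1 := by rw [div_lt_one hN]; linarith
  -- Half the smaller of the two values `1 - p/N` for `p = 2s` and `p = n - 4s`; both are positive
  -- because `n > 4s` and `s > 0`.
  set c := min (1 - 2 * s / ((n : ℝ) - 2 * s)) (1 - ((n : ℝ) - 4 * s) / ((n : ℝ) - 2 * s)) / 2
    with hc
  have hc0 : 0 < c := div_pos (lt_min (by linarith) (by linarith)) two_pos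
  obtain ⟨K, hK2, hK1, hK3⟩ : ∃ K : ℝ, 2 ≤ K ∧ c⁻¹ ≤ K ^ (2 * s) ∧ c⁻¹ ≤ K ^ ((n : ℝ) - 4 * s) :=
    ((eventually_ge_atTop 2).and (((tendsto_rpow_atTop hp1).eventually_ge_atTop _).and
      ((tendsto_rpow_atTop hp2).eventually_ge_atTop _))).exists
  have hK0 : 0 < K := by linarith
  refine ⟨c, K, hc0, hK2, isBubbleConcaveAt_inv_jbracket_rpow hp1 (by linarith) hc0 ?_ hK0 hK1,
    isBubbleConcaveAt_inv_jbracket_rpow hp2 (by linarith) hc0 ?_ hK0 hK3⟩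
  · rw [hc, mul_div_cancel₀ _ two_ne_zero]; exact min_le_left _ _
  · rw [hc, mul_div_cancel₀ _ two_ne_zero]; exact min_le_right _ _

/-- By homogeneity of `F`, the `V`-term is `l^{2s}⟨y⟩^{-2s}` times the `W`-term, which is the lower
bound the tail estimate provides. Its constant involves neither `μ`, `R`, `l` nor `z`. -/
theorem isTruncSupersolutionAt_smoothMin_bubble {c K : ℝ} (hs0 : 0 < s) (hn : 4 * s < n)
    (hc : 0 < c) (hK : 2 ≤ K)
    (h1 : ∀ x : EuclideanSpace ℝ (Fin n),
      IsBubbleConcaveAt s c K (fun y => (jbracket y ^ (2 * s))⁻¹) x)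
    (h2 : ∀ x : EuclideanSpace ℝ (Fin n),
      IsBubbleConcaveAt s c K (fun y => (jbracket y ^ ((n : ℝ) - 4 * s))⁻¹) x)
    {μ R l : ℝ} (hμ0 : 0 < μ) (hμ1 : μ < 1 / 2) (hR : 0 < R) (hl : 0 < l)
    (z x : EuclideanSpace ℝ (Fin n)) :
    IsTruncSupersolutionAt s (c * tailMass n s K)
      (fun x => l ^ (((n : ℝ) - 2 * s) / 2) * smoothMin μ
        (R ^ (2 * s - (n : ℝ)) / jbracket (bubbleCoord l z x) ^ (2 * s))
        (R ^ (-(4 * s)) / jbracket (bubbleCoord l z x) ^ ((n : ℝ) - 4 * s))) x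
      (l ^ (((n : ℝ) + 2 * s) / 2) * smoothMin μ
        (R ^ (2 * s - (n : ℝ)) / jbracket (bubbleCoord l z x) ^ (4 * s))
        (R ^ (-(4 * s)) / jbracket (bubbleCoord l z x) ^ ((n : ℝ) - 2 * s))) := by
  have ha : 0 < R ^ (2 * s - (n : ℝ)) := by positivity
  have hb : 0 < R ^ (-(4 * s)) := by positivity
  set a := R ^ (2 * s - (n : ℝ))
  set b := R ^ (-(4 * s))
  have hl' : 0 < l ^ (((n : ℝ) - 2 * s) / 2) := by positivity
  set w₁ : EuclideanSpace ℝ (Fin n) → ℝ := fun y => a * (jbracket y ^ (2 * s))⁻¹ with hw₁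
  set w₂ : EuclideanSpace ℝ (Fin n) → ℝ := fun y => b * (jbracket y ^ ((n : ℝ) - 4 * s))⁻¹ with hw₂
  have hw₁0 : ∀ y, 0 < w₁ y := fun y => mul_pos ha (inv_jbracket_rpow_pos _ y)
  have hw₂0 : ∀ y, 0 < w₂ y := fun y => mul_pos hb (inv_jbracket_rpow_pos _ y)
  set w : EuclideanSpace ℝ (Fin n) → ℝ := fun y =>
    l ^ (((n : ℝ) - 2 * s) / 2) * smoothMin μ (w₁ y) (w₂ y) with hw
  have hF0 : ∀ y, 0 ≤ smoothMin μ (w₁ y) (w₂ y) := fun y =>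
    smoothMin_nonneg hμ0 hμ1 (hw₁0 y) (hw₂0 y)
  have hw0 : ∀ y, 0 ≤ w y := fun y => mul_nonneg hl'.le (hF0 y)
  have hd : ContDiff ℝ 2 w := contDiff_const.mul (ContDiff.smoothMin hμ0
    (contDiff_const.mul (contDiff_inv_jbracket_rpow _))
    (contDiff_const.mul (contDiff_inv_jbracket_rpow _)) hw₁0 hw₂0)
  have hbdd : ∃ C, ∀ y, |w y| ≤ C := by
    refine ⟨l ^ (((n : ℝ) - 2 * s) / 2) * ((a + b) / 2), fun y => ?_⟩
    rw [abs_of_nonneg (hw0 y)]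
    refine mul_le_mul_of_nonneg_left (smoothMin_le_half_add.trans ?_) hl'.le
    have e1 : w₁ y ≤ a := mul_le_of_le_one_right ha.le (inv_jbracket_rpow_le_one (by linarith) y)
    have e2 : w₂ y ≤ b := mul_le_of_le_one_right hb.le (inv_jbracket_rpow_le_one (by linarith) y)
    linarith
  have hconc : IsBubbleConcaveAt s c K w (bubbleCoord l z x) :=
    (((h1 _).const_mul ha.le).smoothMin ((h2 _).const_mul hb.le) (hw₁0 _) (hw₂0 _)
      hμ0 hμ1).const_mul hl'.le
  have key := hconc.isTruncSupersolutionAt hl hs0 (by linarith) hd.continuous.measurable hbdd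
    hd.contDiffAt hc.le (hw0 _) hK
  convert key using 1
  · funext y
    simp only [hw, hw₁, hw₂, div_eq_mul_inv]
  set y := bubbleCoord l z x
  have hy := jbracket_pos y
  have e1 : a / jbracket y ^ (4 * s) = (jbracket y ^ (2 * s))⁻¹ * w₁ y := by
    rw [hw₁, show 4 * s = 2 * s + 2 * s by ring, Real.rpow_add hy]; field_simp
  have e2 : b / jbracket y ^ ((n : ℝ) - 2 * s) = (jbracket y ^ (2 * s))⁻¹ * w₂ y := by
    rw [hw₂, show (n : ℝ) - 2 * s = 2 * s + (n - 4 * s) by ring, Real.rpow_add hy]; field_simp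
  rw [e1, e2, smoothMin_mul (inv_jbracket_rpow_pos _ y).le,
    show ((n : ℝ) + 2 * s) / 2 = 2 * s + ((n : ℝ) - 2 * s) / 2 by ring, Real.rpow_add hl]
  simp only [hw]
  ring

theorem isTruncSupersolutionAt_weightWInner {c K : ℝ} (hs0 : 0 < s) (hn : 4 * s < n)
    (hc : 0 < c) (hK : 2 ≤ K)
    (h1 : ∀ x : EuclideanSpace ℝ (Fin n),
      IsBubbleConcaveAt s c K (fun y => (jbracket y ^ (2 * s))⁻¹) x)
    {R l : ℝ} (hl : 0 < l) {z x : EuclideanSpace ℝ (Fin n)}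
    (hx : ‖bubbleCoord l z x‖ < R) :
    IsTruncSupersolutionAt s (c * tailMass n s K) (weightWInner s R l z) x
      (weightVInner s R l z x) := by
  have hR : 0 < R := (norm_nonneg _).trans_lt hx
  set a := l ^ (((n : ℝ) - 2 * s) / 2) * R ^ (2 * s - (n : ℝ)) with ha'
  have ha : 0 < a := by positivity
  set w : EuclideanSpace ℝ (Fin n) → ℝ := fun y => a * (jbracket y ^ (2 * s))⁻¹ with hw
  have hw0 : ∀ y, 0 ≤ w y := fun y => (mul_pos ha (inv_jbracket_rpow_pos _ y)).le
  have hd : ContDiff ℝ 2 w := contDiff_const.mul (contDiff_inv_jbracket_rpow _)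
  set S : Set (EuclideanSpace ℝ (Fin n)) := {y | ‖y‖ ≤ R} with hS
  have hSm : MeasurableSet S := (isClosed_le continuous_norm continuous_const).measurableSet
  have hxS : bubbleCoord l z x ∈ S := hx.le
  have hconc : IsBubbleConcaveAt s c K (S.indicator w) (bubbleCoord l z x) :=
    ((h1 _).const_mul ha.le).indicator hxS hw0
  -- The strict inequality `|y| < R` makes the cut-off inactive near the point, which preserves `C²`
  -- regularity there.
  have hev : S.indicator w =ᶠ[𝓝 (bubbleCoord l z x)] w := by
    filter_upwards [continuous_norm.continuousAt.eventually (eventually_lt_nhds hx)] with y hy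
    exact indicator_of_mem (show y ∈ S from le_of_lt hy) w
  have key := hconc.isTruncSupersolutionAt hl hs0 (by linarith)
    (hd.continuous.measurable.indicator hSm)
    ⟨a, fun y => by
      rw [abs_of_nonneg (indicator_nonneg (fun y _ => hw0 y) y)]
      exact (indicator_le_self' (fun y _ => hw0 y) y).trans
        (mul_le_of_le_one_right ha.le (inv_jbracket_rpow_le_one (by linarith) y))⟩
    (hd.contDiffAt.congr_of_eventuallyEq hev) hc.le (indicator_nonneg (fun y _ => hw0 y) _) hK
  convert key using 1
  · funext y
    simp only [weightWInner, Set.indicator, Set.mem_ofPred_eq, hw, ha', hS, div_eq_mul_inv]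
  rw [weightVInner, indicator_of_mem (show x ∈ {x | ‖bubbleCoord l z x‖ ≤ R} from hx.le),
    indicator_of_mem hxS]
  have hy := jbracket_pos (bubbleCoord l z x)
  simp only [hw, ha']
  rw [show 4 * s = 2 * s + 2 * s by ring, Real.rpow_add hy,
    show ((n : ℝ) + 2 * s) / 2 = 2 * s + ((n : ℝ) - 2 * s) / 2 by ring, Real.rpow_add hl]
  field_simp

end Supersolutions

/-! ### The three inequalities with a common constant -/

theorem mainTheorem3 (n : ℕ) (s : ℝ) (hs0 : 0 < s) (hs1 : s < 1) (hn : 4 * s < (n : ℝ)) :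
    ∃ α : ℝ, 0 < α ∧
      -- the model inequality on the whole space
      (∀ x : EuclideanSpace ℝ (Fin n), ∃ L : ℝ,
        HasFracLaplacianAt s
          (fun y : EuclideanSpace ℝ (Fin n) => (1 + ‖y‖ ^ 2) ^ (-s)) x L ∧
        α * (1 + ‖x‖ ^ 2) ^ (-(2 * s)) ≤ L) ∧
      (∀ (ν : ℕ) (lam : Fin ν → ℝ) (z : Fin ν → EuclideanSpace ℝ (Fin n)) (μ R : ℝ)
        (J : Finset (Fin ν)),
        (∀ j, 0 < lam j) → 0 < μ → μ < 1 / 2 → 0 < R →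
        -- the smoothed sums, on the whole space
        (∀ x : EuclideanSpace ℝ (Fin n), ∃ L : ℝ,
          HasFracLaplacianAt s (smoothSumW s μ R lam z J) x L ∧
          α * smoothSumV s μ R lam z J x ≤ L) ∧
        -- the full weights, where the cut-off of the inner weight is inactive
        (∀ (i : Fin ν) (x : EuclideanSpace ℝ (Fin n)),
          ‖bubbleCoord (lam i) (z i) x‖ < R → ∃ L : ℝ,
          HasFracLaplacianAt s (tildeW s μ R lam z i J) x L ∧
          α * tildeV s μ R lam z i J x ≤ L)) := by
  have hn1 : 1 ≤ n := by
    rw [Nat.one_le_iff_ne_zero]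
    rintro rfl
    simp only [Nat.cast_zero] at hn
    linarith
  obtain ⟨c, K, hc, hK, h1, h2⟩ := exists_isBubbleConcaveAt hs0 hn
  have hsum : ∀ {ν : ℕ} {lam : Fin ν → ℝ} (z : Fin ν → EuclideanSpace ℝ (Fin n)) {μ R : ℝ}
      (J : Finset (Fin ν)), (∀ j, 0 < lam j) → 0 < μ → μ < 1 / 2 → 0 < R → ∀ x,
      IsTruncSupersolutionAt s (c * tailMass n s K) (smoothSumW s μ R lam z J) x
        (smoothSumV s μ R lam z J x) := by
    intro ν lam z μ R J hlam hμ0 hμ1 hR x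
    exact IsTruncSupersolutionAt.sum hs0 J fun j _ =>
      isTruncSupersolutionAt_smoothMin_bubble hs0 hn hc hK h1 h2 hμ0 hμ1 hR (hlam j) (z j) x
  refine ⟨fracLapConst n s * (c * tailMass n s K),
    mul_pos (fracLapConst_pos n hs0 hs1) (mul_pos hc (tailMass_pos hn1 hs0 (by linarith))),
    fun x => ?_, fun ν lam z μ R J hlam hμ0 hμ1 hR => ⟨fun x => ?_, fun i x hx => ?_⟩⟩
  · have hd : ContDiff ℝ 2 fun y : EuclideanSpace ℝ (Fin n) => (jbracket y ^ (2 * s))⁻¹ :=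
      contDiff_inv_jbracket_rpow _
    have hcoord : ∀ y : EuclideanSpace ℝ (Fin n), bubbleCoord 1 0 y = y := fun y => by
      simp [bubbleCoord]
    -- The model inequality is the case of the unit bubble, `l = 1` and `z = 0`.
    have key := (h1 (bubbleCoord 1 0 x)).isTruncSupersolutionAt one_pos hs0 (by linarith)
      hd.continuous.measurable
      ⟨1, fun y => by
        rw [abs_of_pos (inv_jbracket_rpow_pos _ y)]
        exact inv_jbracket_rpow_le_one (by linarith) y⟩
      hd.contDiffAt hc.le (inv_jbracket_rpow_pos _ _).le hK
    simp only [hcoord] at key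
    have hpow : ∀ (p : ℝ) (y : EuclideanSpace ℝ (Fin n)),
        (1 + ‖y‖ ^ 2) ^ (-p) = (jbracket y ^ (2 * p))⁻¹ := fun p y => by
      rw [← jbracket_sq, ← Real.rpow_natCast, ← Real.rpow_mul (jbracket_pos y).le,
        ← Real.rpow_neg (jbracket_pos y).le]
      congr 1
      push_cast
      ring
    simp only [hpow]
    convert key.exists_hasFracLaplacianAt hn1 hs0 hs1 using 5
    rw [Real.one_rpow, one_mul, ← mul_inv, ← Real.rpow_add (jbracket_pos x)]
    congr 2
    ring
  · exact (hsum z J hlam hμ0 hμ1 hR x).exists_hasFracLaplacianAt hn1 hs0 hs1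
  · exact ((hsum z J hlam hμ0 hμ1 hR x).add hs0
      (isTruncSupersolutionAt_weightWInner hs0 hn hc hK h1 (hlam i)
        hx)).exists_hasFracLaplacianAt hn1 hs0 hs1
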